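/- Let $P=(X,\prec)$ be a finite poset. An interval representation of $P$ is a family of nonempty compact real intervals $\{I_x=[\ell_x,r_x] : x\in X\}$ (with $\ell_x\le r_x$) such that, for all $x,y\in X$, $x\prec y$ if and only if $I_x$ lies entirely to the left of $I_y$, i.e. $r_x<\ell_y$; $P$ is an interval order if it has such a representation. The representation is $2$-count if the set of lengths $\{r_x-\ell_x : x\in X\}$ has exactly two elements. The height of $P$ is the number of elements of a longest chain of $P$. The depth of an interval order $P$ is the maximum cardinality of a set $A\subseteq X$ such that in every interval representation of $P$ the intervals $I_x$, $x\in A$, form a nested chain, i.e. for any two distinct $x,y\in A$ either $I_x\subsetneq I_y$ or $I_y\subsetneq I_x$. Theorem. An interval order of height $3$ has a $2$-count interval representation if and only if its depth is at most $2$. -/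

import Mathlib

/-- An interval representation of a poset: to each element `x` a nonempty compact real interval
`[left x, right x]` (possibly a single point), such that `x < y` exactly when the interval of `x`
lies entirely to the left of the interval of `y`. -/
structure IntervalRep (X : Type*) [PartialOrder X] where
  left : X → ℝ
  right : X → ℝ
  left_le_right : ∀ x, left x ≤ right x
  lt_iff : ∀ x y, x < y ↔ right x < left y

namespace IntervalRep

variable {X : Type*} [PartialOrder X]

/-- The interval that represents `x`. -/
def interval (R : IntervalRep X) (x : X) : Set ℝ := Set.Icc (R.left x) (R.right x)

/-- The length of the interval that represents `x`. -/
def length (R : IntervalRep X) (x : X) : ℝ := R.right x - R.left x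

/-- The representation uses exactly `k` distinct interval lengths. -/
def IsKCount (R : IntervalRep X) (k : ℕ) : Prop := (Set.range R.length).encard = k

/-- The intervals of the elements of `A` form a nested chain: of any two of them, one is properly
contained in the other. -/
def IsNested (R : IntervalRep X) (A : Set X) : Prop :=
  IsChain (fun x y => R.interval x ⊂ R.interval y) A

end IntervalRep

/-- A finite poset is an interval order if it has an interval representation. -/
def IsIntervalOrder (X : Type*) [PartialOrder X] : Prop := Finite X ∧ Nonempty (IntervalRep X)

/-- The poset has a representation with exactly `k` distinct interval lengths. -/
def HasKCountRep (X : Type*) [PartialOrder X] (k : ℕ) : Prop := ∃ R : IntervalRep X, R.IsKCount k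

/-- The height of a poset: the number of elements of a longest chain. -/
noncomputable def posetHeight (X : Type*) [PartialOrder X] : ℕ∞ :=
  (Set.univ : Set X).chainHeight (· < ·)

/-- The depth of an interval order: the largest number of elements of a set whose intervals form
a nested chain in every interval representation. -/
noncomputable def intervalDepth (X : Type*) [PartialOrder X] : ℕ∞ :=
  ⨆ A : {A : Set X // ∀ R : IntervalRep X, R.IsNested A}, (A : Set X).encard

/-! Nested intervals differ in length, so a 2-count representation bounds the depth by 2.
Conversely, height 3 lets a point `p` cut the order into three antichains. The intervals through `p`
become `[f x, M + f x + δ x]` with `M` large and `δ x ∈ {0, 1}`. Intervals left of `p` matter only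
through their right ends, those right of `p` only through their left ends, so it suffices that `f`
respects the order of left ends and `f + δ` that of right ends. With `δ = 1` exactly on the elements
that must enclose another, depth at most 2 forbids forced nesting among these, and
`exists_shift_of_forall_not_nested` yields `f`. -/

open Finset in
/-- Two integer ranks on a finite set are realized by points `f x` and `f x + δ x` with shifts
`δ x ∈ {0, 1}` if the set splits into two parts on each of which the ranks are compatible, and no
member of the first part encloses any element. -/
theorem exists_shift_of_forall_not_nested {α : Type*} [Finite α] (i j : α → ℤ) (S : α → Prop)
    (hS : ∀ x y, S x → i x < i y → ¬ j y < j x)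
    (hT : ∀ x y, ¬ S x → ¬ S y → i x < i y → ¬ j y < j x) :
    ∃ f δ : α → ℝ, (∀ x, δ x = 0 ∨ δ x = 1) ∧ (∀ x y, i x < i y → f x < f y) ∧
      ∀ x y, j x < j y → f x + δ x < f y + δ y := by
  classical
  have := Fintype.ofFinite α
  -- Points are placed in lexicographic order of ranks; `S` marks the short ones. The last invariant
  -- keeps `f q + 1`, for `q` long, above every point placed before a short `p` with `j q < j p`
  -- appears.
  have key : ∀ s : Finset α, ∃ f : α → ℝ,
      (∀ x ∈ s, ∀ y ∈ s, toLex (i x, j x) < toLex (i y, j y) → f x < f y) ∧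
      (∀ q ∈ s, ∀ p ∈ s, ¬ S q → S p → j q < j p → f q + 1 < f p) ∧
      (∀ q ∈ s, ∀ y ∈ s, ¬ S q → (∀ p ∈ s, S p → toLex (i p, j p) ≤ toLex (i y, j y) →
        ¬ j q < j p) → f y < f q + 1) := by
    intro s
    induction s using Finset.induction_on_max_value (fun x => toLex (i x, j x)) with
    | empty => exact ⟨0, by simp⟩
    | insert e s he hmax ih =>
      obtain ⟨f, h₁, h₂, h₃⟩ := ih
      obtain ⟨m, hlo, hhi⟩ := Order.exists_between_finsets
        (s.image f ∪ (s.filter fun q => ¬ S q ∧ S e ∧ j q < j e).image fun q => f q + 1)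
        ((s.filter fun q => ¬ S q ∧ ∀ p ∈ insert e s, S p → ¬ j q < j p).image fun q => f q + 1)
        (by
          intro a ha b hb
          obtain ⟨q, hq, rfl⟩ := mem_image.1 hb
          obtain ⟨hqs, hqS, hqp⟩ := mem_filter.1 hq
          rcases mem_union.1 ha with ha | ha
          · obtain ⟨y, hy, rfl⟩ := mem_image.1 ha
            exact h₃ q hqs y hy hqS fun p hp hpS _ => hqp p (mem_insert_of_mem hp) hpS
          · obtain ⟨q', hq', rfl⟩ := mem_image.1 ha
            obtain ⟨hqs', hqS', heS, hlt⟩ := mem_filter.1 hq'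
            have hle := hqp e (mem_insert_self _ _) heS
            -- Long elements do not nest, so this forces `f q' < f q` and the two bounds on the new
            -- point agree.
            have : j q' < j q := by omega
            have hi := hT q q' hqS hqS'
            have := h₁ q' hqs' q hqs (by rw [Prod.Lex.toLex_lt_toLex]; dsimp; omega)
            linarith)
      have hf : ∀ y ∈ s, f y < m := fun y hy =>
        hlo _ (mem_union_left _ (mem_image_of_mem _ hy))
      have hne : ∀ y ∈ s, y ≠ e := fun y hy h => he (h ▸ hy)
      refine ⟨Function.update f e m, ?_, ?_, ?_⟩
      · intro x hx y hy hxy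
        rcases mem_insert.1 hx with rfl | hxs <;> rcases mem_insert.1 hy with rfl | hys
        · exact absurd hxy (lt_irrefl _)
        · exact absurd hxy (hmax y hys).not_gt
        · simpa [hne x hxs] using hf x hxs
        · simpa [hne x hxs, hne y hys] using h₁ x hxs y hys hxy
      · intro q hq p hp hqS hpS hj
        rcases mem_insert.1 hq with rfl | hqs <;> rcases mem_insert.1 hp with rfl | hps
        · exact absurd hpS hqS
        · have hle := hmax p hps
          have := hS p q hpS
          rw [Prod.Lex.toLex_le_toLex] at hle
          dsimp at hle
          omega
        · have := hlo (f q + 1) (mem_union_right _ (mem_image.2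
            ⟨q, mem_filter.2 ⟨hqs, hqS, hpS, hj⟩, rfl⟩))
          simpa [hne q hqs] using this
        · simpa [hne q hqs, hne p hps] using h₂ q hqs p hps hqS hpS hj
      · intro q hq y hy hqS hp
        rcases mem_insert.1 hq with rfl | hqs <;> rcases mem_insert.1 hy with rfl | hys
        · simp
        · have := hf y hys
          simp only [Function.update_self, Function.update_of_ne (hne y hys)]
          linarith
        · have := hhi (f q + 1) (mem_image.2 ⟨q, mem_filter.2 ⟨hqs, hqS, fun p hps hpS =>
            hp p hps hpS ?_⟩, rfl⟩)
          · simpa [hne q hqs] using this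
          · rcases mem_insert.1 hps with rfl | hps
            exacts [le_rfl, hmax p hps]
        · simpa [hne q hqs, hne y hys] using h₃ q hqs y hys hqS fun p hps =>
            hp p (mem_insert_of_mem hps)
  obtain ⟨f, h₁, h₂, h₃⟩ := key univ
  have hlex : ∀ x y, ¬ (i y < i x ∧ j x < j y) → j x < j y → f x < f y := by
    intro x y hn hj
    refine h₁ x (mem_univ _) y (mem_univ _) ?_
    rw [Prod.Lex.toLex_lt_toLex]
    dsimp
    omega
  refine ⟨f, fun x => if S x then 0 else 1, fun x => by dsimp; split_ifs <;> simp,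
    fun x y h => h₁ x (mem_univ _) y (mem_univ _) (Prod.Lex.toLex_lt_toLex.2 (Or.inl h)), ?_⟩
  intro x y hj
  by_cases hx : S x <;> by_cases hy : S y <;> simp only [hx, hy, if_true, if_false, add_zero]
  · exact hlex x y (fun h => hS y x hy h.1 h.2) hj
  -- A short `p` up to `x` with `j y < j p` would enclose `x`.
  · refine h₃ y (mem_univ _) x (mem_univ _) hy fun p _ hp hle => ?_
    rw [Prod.Lex.toLex_le_toLex] at hle
    dsimp at hle
    have := hS p x hp
    omega
  · exact h₂ x (mem_univ _) y (mem_univ _) hx hy hj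
  · have := hlex x y (fun h => hT y x hy hx h.1 h.2) hj
    linarith

/-! ### Forced nesting, depth and height -/

section

variable {X : Type*} [PartialOrder X]

/-- The interval of `x` is properly contained in that of `y` in every representation, as some
`a < x < b` has both `a` and `b` incomparable to `y`. -/
def ForcedInside (x y : X) : Prop := (∃ a, a < x ∧ ¬ a < y) ∧ ∃ b, x < b ∧ ¬ y < b

theorem ForcedInside.ssubset {x y : X} (h : ForcedInside x y) (R : IntervalRep X) :
    R.interval x ⊂ R.interval y := by
  obtain ⟨⟨a, ha, hay⟩, b, hb, hyb⟩ := h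
  rw [R.lt_iff] at ha hay hb hyb
  rw [not_lt] at hay hyb
  have := R.left_le_right x
  refine ⟨Set.Icc_subset_Icc (by linarith) (by linarith), fun hs => ?_⟩
  have := (hs (Set.left_mem_Icc.2 (R.left_le_right y))).1
  linarith

theorem not_forcedInside_of_intervalDepth_le_two (hR : Nonempty (IntervalRep X))
    (hd : intervalDepth X ≤ 2) {x y z : X} (hxy : ForcedInside x y) : ¬ ForcedInside y z := by
  intro hyz
  obtain ⟨R₀⟩ := hR
  have hne : x ≠ y ∧ x ≠ z ∧ y ≠ z := by
    refine ⟨?_, ?_, ?_⟩ <;> rintro rfl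
    · exact (hxy.ssubset R₀).ne rfl
    · exact ((hxy.ssubset R₀).trans (hyz.ssubset R₀)).ne rfl
    · exact (hyz.ssubset R₀).ne rfl
  have hA : ∀ R : IntervalRep X, R.IsNested {x, y, z} := by
    intro R
    have h₁ := hxy.ssubset R
    have h₂ := hyz.ssubset R
    have h₃ := h₁.trans h₂
    rintro u (rfl | rfl | rfl) v (rfl | rfl | rfl) huv <;> simp_all
  have := (le_iSup (fun A : {A : Set X // ∀ R : IntervalRep X, R.IsNested A} =>
    (A : Set X).encard) ⟨_, hA⟩).trans hd
  have h3 : ({x, y, z} : Set X).encard = 3 :=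
    Set.encard_eq_three.2 ⟨x, y, z, hne.1, hne.2.1, hne.2.2, rfl⟩
  rw [h3] at this
  exact absurd this (by decide)

theorem intervalDepth_le_of_isKCount {k : ℕ} (R : IntervalRep X) (hR : R.IsKCount k) :
    intervalDepth X ≤ k := by
  refine iSup_le fun ⟨A, hA⟩ => ?_
  rw [← hR]
  have hinj : Set.InjOn R.length A := by
    intro x hx y hy hxy
    by_contra hne
    have aux : ∀ u v : X, R.length u = R.length v → ¬ R.interval u ⊂ R.interval v := by
      intro u v huv h
      obtain ⟨h₁, h₂⟩ := (Set.Icc_subset_Icc_iff (R.left_le_right u)).1 h.1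
      simp only [IntervalRep.length] at huv
      refine h.2 (Set.Icc_subset_Icc ?_ ?_) <;> linarith
    rcases hA R hx hy hne with h | h
    exacts [aux _ _ hxy h, aux _ _ hxy.symm h]
  rw [← hinj.encard_image]
  exact Set.encard_le_encard (Set.image_subset_range _ _)

theorem not_lt_chain_four_of_posetHeight_eq_three (h : posetHeight X = 3) {a b c d : X}
    (hab : a < b) (hbc : b < c) : ¬ c < d := by
  intro hcd
  have hac := hab.trans hbc
  have had := hac.trans hcd
  have hbd := hbc.trans hcd
  have hchain : IsChain (· < ·) ({a, b, c, d} : Set X) := by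
    rintro u (rfl | rfl | rfl | rfl) v (rfl | rfl | rfl | rfl) huv <;> simp_all
  have := Set.encard_le_chainHeight_of_isChain _ _ (Set.subset_univ _) hchain
  rw [← posetHeight, h, Set.encard_insert_of_notMem (by simp [hab.ne, hac.ne, had.ne]),
    Set.encard_eq_three.2 ⟨b, c, d, hbc.ne, hbd.ne, hcd.ne, rfl⟩] at this
  exact absurd this (by decide)

theorem exists_lt_chain_three_of_posetHeight_eq_three (h : posetHeight X = 3) :
    ∃ a b c : X, a < b ∧ b < c := by
  obtain ⟨t, -, ht, hc⟩ := Set.exists_isChain_of_le_chainHeight (r := (· < ·))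
    (s := (Set.univ : Set X)) 3 (by rw [← posetHeight, h]; rfl)
  obtain ⟨x, y, z, hxy, hxz, hyz, rfl⟩ := Set.encard_eq_three.1 ht
  have h₁ := hc (by simp) (by simp) hxy
  have h₂ := hc (by simp) (by simp) hxz
  have h₃ := hc (by simp) (by simp) hyz
  rcases h₁ with h₁ | h₁ <;> rcases h₂ with h₂ | h₂ <;> rcases h₃ with h₃ | h₃
  exacts [⟨_, _, _, h₁, h₃⟩, ⟨_, _, _, h₂, h₃⟩, ⟨_, _, _, h₁, h₃.trans h₂⟩, ⟨_, _, _, h₂, h₁⟩,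
    ⟨_, _, _, h₁, h₂⟩, ⟨_, _, _, h₁, h₂⟩, ⟨_, _, _, h₃, h₂⟩, ⟨_, _, _, h₃, h₁⟩]

/-- Number of elements below `x`; it orders the left ends in a canonical representation. -/
noncomputable def leftRank (x : X) : ℤ := (Set.Iio x).ncard

/-- Minus the number of elements above `x`; it orders the right ends in a canonical
representation. -/
noncomputable def rightRank (x : X) : ℤ := -(Set.Ioi x).ncard

/-- In an interval order the sets `Set.Iio x` are linearly ordered by inclusion, so comparing
cardinalities is comparing sets. -/
theorem IntervalRep.leftRank_lt_iff [Finite X] (R : IntervalRep X) {x y : X} :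
    leftRank x < leftRank y ↔ ∃ a, a < y ∧ ¬ a < x := by
  unfold leftRank
  rw [Nat.cast_lt]
  constructor
  · intro h
    by_contra! hn
    exact h.not_ge (Set.ncard_le_ncard hn (Set.toFinite _))
  · rintro ⟨a, hay, hax⟩
    refine Set.ncard_lt_ncard ⟨fun c hc => ?_, fun hs => hax (hs hay)⟩ (Set.toFinite _)
    rw [Set.mem_Iio] at *
    rw [R.lt_iff] at *
    linarith

theorem IntervalRep.rightRank_lt_iff [Finite X] (R : IntervalRep X) {x y : X} :
    rightRank x < rightRank y ↔ ∃ b, x < b ∧ ¬ y < b := by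
  unfold rightRank
  rw [neg_lt_neg_iff, Nat.cast_lt]
  constructor
  · intro h
    by_contra! hn
    exact h.not_ge (Set.ncard_le_ncard hn (Set.toFinite _))
  · rintro ⟨b, hxb, hyb⟩
    refine Set.ncard_lt_ncard ⟨fun c hc => ?_, fun hs => hyb (hs hxb)⟩ (Set.toFinite _)
    rw [Set.mem_Ioi] at *
    rw [R.lt_iff] at *
    linarith

/-- An interval order of height three splits at a point `p` of any representation into three
antichains: the intervals left of `p`, those that contain `p`, and those right of `p`. -/
theorem IntervalRep.exists_antichain_split [Finite X] (R : IntervalRep X)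
    (h : posetHeight X = 3) :
    ∃ p : ℝ, (∃ a, R.right a < p) ∧ (∃ b, p < R.left b) ∧
      (∀ x y, R.right x < p → R.right y < p → ¬ x < y) ∧
      ∀ x y, p < R.left x → p < R.left y → ¬ x < y := by
  obtain ⟨a, b, c, hab, hbc⟩ := exists_lt_chain_three_of_posetHeight_eq_three h
  -- `m` ends first among non-minimal elements, so whatever ends earlier is minimal; a relation `x <
  -- y` to the right of `m` would give the chain `l < m < x < y`.
  obtain ⟨m, ⟨l, hlm⟩, hmin⟩ := Set.exists_min_image {x : X | ∃ a, a < x} R.right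
    (Set.toFinite _) ⟨b, a, hab⟩
  refine ⟨R.right m, ⟨l, ?_⟩, ⟨c, ?_⟩, ?_, ?_⟩
  · exact ((R.lt_iff _ _).1 hlm).trans_le (R.left_le_right m)
  · exact (hmin b ⟨a, hab⟩).trans_lt ((R.lt_iff _ _).1 hbc)
  · exact fun x y _ hy hxy => hy.not_ge (hmin y ⟨x, hxy⟩)
  · exact fun x y hx _ =>
      not_lt_chain_four_of_posetHeight_eq_three h hlm ((R.lt_iff _ _).2 hx)

/-! ### Construction of the 2-count representation -/

theorem hasKCountRep_two_of_intervalDepth_le_two (hX : IsIntervalOrder X)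
    (hh : posetHeight X = 3) (hd : intervalDepth X ≤ 2) : HasKCountRep X 2 := by
  classical
  obtain ⟨hfin, ⟨R⟩⟩ := hX
  have := Fintype.ofFinite X
  have hforced : ∀ x y : X, leftRank x < leftRank y → rightRank y < rightRank x →
      ForcedInside y x := fun x y h₁ h₂ => ⟨R.leftRank_lt_iff.1 h₁, R.rightRank_lt_iff.1 h₂⟩
  obtain ⟨f, δ, hδ, hf, hg⟩ := exists_shift_of_forall_not_nested (leftRank (X := X)) rightRank
    (fun x => ¬ ∃ y, ForcedInside y x) (fun x y hx h₁ h₂ => hx ⟨y, hforced x y h₁ h₂⟩) (by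
      intro x y _ hy h₁ h₂
      obtain ⟨z, hz⟩ := not_not.1 hy
      exact not_forcedInside_of_intervalDepth_le_two ⟨R⟩ hd hz (hforced x y h₁ h₂))
  -- The threshold `r` becomes the right end of `a` when `a` lies left of `p`; `lam` is the mirror
  -- image.
  have hρ : ∀ a : X, ∃ r : ℝ, ∀ x, a < x ↔ r < f x := by
    intro a
    obtain ⟨r, h₁, h₂⟩ := Order.exists_between_finsets
      ((Finset.univ.filter fun x => ¬ a < x).image f) ((Finset.univ.filter fun x => a < x).image f)
      (by
        simp only [Finset.mem_image, Finset.mem_filter, Finset.mem_univ, true_and]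
        rintro _ ⟨x, hx, rfl⟩ _ ⟨y, hy, rfl⟩
        exact hf x y (R.leftRank_lt_iff.2 ⟨a, hy, hx⟩))
    simp only [Finset.mem_image, Finset.mem_filter, Finset.mem_univ, true_and] at h₁ h₂
    exact ⟨r, fun x => ⟨fun h => h₂ _ ⟨x, h, rfl⟩, fun h => by
      by_contra hn
      exact h.not_gt (h₁ _ ⟨x, hn, rfl⟩)⟩⟩
  have hlam : ∀ b : X, ∃ l : ℝ, ∀ x, x < b ↔ f x + δ x < l := by
    intro b
    obtain ⟨l, h₁, h₂⟩ := Order.exists_between_finsets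
      ((Finset.univ.filter fun x => x < b).image fun x => f x + δ x)
      ((Finset.univ.filter fun x => ¬ x < b).image fun x => f x + δ x)
      (by
        simp only [Finset.mem_image, Finset.mem_filter, Finset.mem_univ, true_and]
        rintro _ ⟨x, hx, rfl⟩ _ ⟨y, hy, rfl⟩
        exact hg x y (R.rightRank_lt_iff.2 ⟨b, hx, hy⟩))
    simp only [Finset.mem_image, Finset.mem_filter, Finset.mem_univ, true_and] at h₁ h₂
    exact ⟨l, fun x => ⟨fun h => h₁ _ ⟨x, h, rfl⟩, fun h => by
      by_contra hn
      exact h.not_gt (h₂ _ ⟨x, hn, rfl⟩)⟩⟩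
  choose ρ hρ using hρ
  choose lam hlam using hlam
  obtain ⟨p, ⟨a₀, ha₀⟩, ⟨b₀, hb₀⟩, hL, hRt⟩ := R.exists_antichain_split hh
  obtain ⟨K, hK⟩ : ∃ K : ℝ, ∀ x, |f x| + |ρ x| + |lam x| ≤ K := by
    obtain ⟨K, hK⟩ := (Set.finite_range fun x => |f x| + |ρ x| + |lam x|).bddAbove
    exact ⟨K, fun x => hK ⟨x, rfl⟩⟩
  have hbd : ∀ x, (-K ≤ f x ∧ f x ≤ K) ∧ (-K ≤ ρ x ∧ ρ x ≤ K) ∧ -K ≤ lam x ∧ lam x ≤ K := by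
    intro x
    have := hK x
    refine ⟨abs_le.1 ?_, abs_le.1 ?_, abs_le.1 ?_⟩ <;>
      linarith [abs_nonneg (f x), abs_nonneg (ρ x), abs_nonneg (lam x)]
  have hK0 : 0 ≤ K := by linarith [hbd a₀]
  have hδ' : ∀ x, 0 ≤ δ x ∧ δ x ≤ 1 := by
    intro x
    rcases hδ x with h | h <;> rw [h] <;> norm_num
  -- Any `M > 2 * K` would make each outer part overlap itself and separate left from right.
  obtain ⟨M, hM⟩ : ∃ M : ℝ, M = 4 * K + 4 := ⟨_, rfl⟩
  have hdisj : ∀ x, R.right x < p → ¬ p < R.left x := fun x h₁ h₂ => by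
    linarith [R.left_le_right x]
  let ℓ : X → ℝ := fun x =>
    if R.right x < p then ρ x - M else if p < R.left x then M + lam x else f x
  -- `δ` may be constant on the middle part; the outer parts ensure that both lengths occur.
  let len : X → ℝ := fun x =>
    if R.right x < p then M else if p < R.left x then M + 1 else M + δ x
  have hlen : ∀ x, len x = M ∨ len x = M + 1 := by
    intro x
    dsimp only [len]
    split_ifs
    · exact Or.inl rfl
    · exact Or.inr rfl
    · rcases hδ x with h | h <;> simp [h]
  let R' : IntervalRep X :=
    { left := ℓ
      right := fun x => ℓ x + len x
      left_le_right := fun x => by rcases hlen x with h | h <;> rw [h] <;> linarith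
      lt_iff := by
        intro x y
        have hx := hbd x
        have hy := hbd y
        have hdx := hδ' x
        have hdy := hδ' y
        have hRlt := R.lt_iff x y
        have hlx := R.left_le_right x
        have hly := R.left_le_right y
        by_cases hxL : R.right x < p
        · by_cases hyL : R.right y < p
          · simp only [ℓ, len, hxL, hyL, if_true]
            exact iff_of_false (hL x y hxL hyL) (by linarith)
          · by_cases hyR : p < R.left y
            · simp only [ℓ, len, hxL, hyL, hyR, if_true, if_false]
              exact iff_of_true (hRlt.2 (by linarith)) (by linarith)
            · simp only [ℓ, len, hxL, hyL, hyR, if_true, if_false, sub_add_cancel]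
              exact hρ x y
        · by_cases hyL : R.right y < p
          · have : ¬ x < y := by rw [hRlt]; linarith
            refine iff_of_false this ?_
            simp only [ℓ, len, hxL, hyL, if_true, if_false]
            split_ifs <;> linarith
          · by_cases hxR : p < R.left x
            · by_cases hyR : p < R.left y
              · simp only [ℓ, len, hxL, hyL, hxR, hyR, if_true, if_false]
                exact iff_of_false (hRt x y hxR hyR) (by linarith)
              · simp only [ℓ, len, hxL, hyL, hxR, hyR, if_true, if_false]
                exact iff_of_false (by rw [hRlt]; linarith) (by linarith)
            · by_cases hyR : p < R.left y
              · simp only [ℓ, len, hxL, hyL, hxR, hyR, if_true, if_false]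
                rw [hlam y x]
                constructor <;> intro h <;> linarith
              · simp only [ℓ, len, hxL, hyL, hxR, hyR, if_false]
                exact iff_of_false (by rw [hRlt]; linarith) (by linarith) }
  have hlength : R'.length = len := funext fun x => add_sub_cancel_left _ _
  have hrange : Set.range R'.length = {M, M + 1} := by
    rw [hlength]
    refine Set.Subset.antisymm ?_ ?_
    · rintro _ ⟨x, rfl⟩
      exact hlen x
    · rintro _ (rfl | rfl)
      · exact ⟨a₀, by simp [len, ha₀]⟩
      · exact ⟨b₀, by simp only [len, hb₀, if_neg fun h => hdisj b₀ h hb₀, if_true]⟩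
  refine ⟨R', ?_⟩
  rw [IntervalRep.IsKCount, hrange, Set.encard_pair (by simp)]
  rfl

end

theorem mainTheorem2 {X : Type*} [PartialOrder X] (hX : IsIntervalOrder X)
    (hheight : posetHeight X = 3) :
    HasKCountRep X 2 ↔ intervalDepth X ≤ 2 :=
  ⟨fun ⟨R, hR⟩ => intervalDepth_le_of_isKCount R hR,
    hasKCountRep_two_of_intervalDepth_le_two hX hheight⟩
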